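/- A \emph{bipartite graph} is a relational structure $\Gamma=(V,E,P)$ in which $E$ is an irreflexive symmetric binary relation on $V$, $P=(V_0\times V_0)\cup(V_1\times V_1)$ for some partition $V=V_0\mathbin{\dot\cup}V_1$, and $E\cap P=\varnothing$. A homomorphism of bipartite graphs is a map of vertices preserving both relations $E$ and $P$ (in the forward direction). Let $B=(V,E,P)$ be the countable universal bipartite graph, i.e. the Fraïssé limit of the class of finite bipartite graphs, and let $M=\operatorname{End}B$ be its endomorphism monoid, with maps written on the right. For $f,g\in M$ write $f\,\mathscr L\,g$ if $Mf=Mg$, $f\,\mathscr R\,g$ if $fM=gM$, and let $\mathscr D=\mathscr L\circ\mathscr R$. The image of $f\in M$ is the structure $\operatorname{im}f=(Vf,Ef,Pf)$, and $f$ is \emph{regular} if $fgf=f$ for some $g\in M$. Let $K_{1,1}$ be the complete bipartite graph with both parts of size one. \textbf{Theorem.} Let $f$ be a regular endomorphism of $B$. \begin{enumerate} \item[(i)] If $\operatorname{im}f$ is infinite, then the $\mathscr D$-class of $f$ contains exactly $2^{\aleph_0}$ $\mathscr L$-classes and exactly $2^{\aleph_0}$ $\mathscr R$-classes. \item[(ii)]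 If $\operatorname{im}f$ is finite but not isomorphic to $K_{1,1}$, then the $\mathscr D$-class of $f$ contains exactly $\aleph_0$ $\mathscr L$-classes and exactly $2^{\aleph_0}$ $\mathscr R$-classes. \item[(iii)] If $\operatorname{im}f\cong K_{1,1}$, then the $\mathscr D$-class of $f$ contains exactly $\aleph_0$ $\mathscr L$-classes and exactly one $\mathscr R$-class. \end{enumerate} -/

import Mathlib

open scoped FirstOrder Cardinal

universe u

/-! ### Green's relations in a monoid -/

namespace Green

variable {S : Type u} [Monoid S]

/-- `f` and `g` generate the same left ideal: `S f = S g`. -/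
def LRel (f g : S) : Prop := Set.range (fun m : S => m * f) = Set.range (fun m : S => m * g)

/-- `f` and `g` generate the same right ideal: `f S = g S`. -/
def RRel (f g : S) : Prop := Set.range (fun m : S => f * m) = Set.range (fun m : S => g * m)

/-- Green's relation `D`, the composite of `L` and `R`. -/
def DRel (f g : S) : Prop := ∃ h : S, LRel f h ∧ RRel h g

/-- The set of all `L`-classes contained in the `D`-class of `f`. -/
def lClassesInDClass (f : S) : Set (Set S) := {C | ∃ g, DRel f g ∧ C = {h | LRel g h}}

/-- The set of all `R`-classes contained in the `D`-class of `f`. -/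
def rClassesInDClass (f : S) : Set (Set S) := {C | ∃ g, DRel f g ∧ C = {h | RRel g h}}

/-- `f` is a regular element: `f g f = f` for some `g`. -/
def IsRegularElement (f : S) : Prop := ∃ g : S, f * g * f = f

end Green

/-! ### Bipartite graphs as relational structures -/

namespace Bipartite

section

open FirstOrder FirstOrder.Language FirstOrder.Language.Structure

/-- Two binary relation symbols: the edge relation and the partition relation. -/
inductive Rel : ℕ → Type
  | edge : Rel 2
  | part : Rel 2

/-- The relational language with the two binary relation symbols `edge` and `part`. -/
def lang : Language := ⟨fun _ => Empty, Rel⟩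

/-- The symbol of the edge relation. -/
abbrev edgeSymb : lang.Relations 2 := Rel.edge

/-- The symbol of the partition relation. -/
abbrev partSymb : lang.Relations 2 := Rel.part

instance : lang.IsRelational := fun _ => inferInstanceAs (IsEmpty Empty)

section Basic

variable (M : Type u) [lang.Structure M]

variable {M} in
/-- `u` and `v` are joined by an edge. -/
def Edge (u v : M) : Prop := RelMap edgeSymb ![u, v]

variable {M} in
/-- `u` and `v` are related under the partition relation. -/
def Part (u v : M) : Prop := RelMap partSymb ![u, v]

/-- The relational structure `(M, E, P)` is a bipartite graph: `E` is irreflexive and symmetric,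
`P = (V₀ × V₀) ∪ (V₁ × V₁)` for a subset `V₀` of `M` with complement `V₁`, and `E` and `P` are
disjoint. -/
structure IsBipartiteGraph : Prop where
  irrefl : ∀ u : M, ¬ Edge u u
  symm : ∀ u v : M, Edge u v → Edge v u
  part : ∃ V₀ : Set M, ∀ u v : M, Part u v ↔ (u ∈ V₀ ∧ v ∈ V₀) ∨ (u ∈ V₀ᶜ ∧ v ∈ V₀ᶜ)
  disjoint : ∀ u v : M, Edge u v → ¬ Part u v

end Basic

/-- The class of finite bipartite graphs. (As is usual for Fraïssé limits in Mathlib, the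
empty structure is included.) -/
def finiteBipartiteGraphs : Set (CategoryTheory.Bundled.{u} lang.Structure) :=
  {N | Finite N ∧ IsBipartiteGraph N}

/-- `B` is (a copy of) the countable universal bipartite graph, that is, the Fraïssé limit of the
class of finite bipartite graphs. -/
def IsCountableUniversal (B : Type u) [lang.Structure B] [Countable B] : Prop :=
  IsFraisseLimit (L := lang) finiteBipartiteGraphs.{u} B

/-- The complete bipartite graph `K_{m,n}` on parts of sizes `m` and `n`. -/
def CompleteGraph (m n : ℕ) : Type := Fin m ⊕ Fin n

instance (m n : ℕ) : lang.Structure (CompleteGraph m n) where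
  funMap f _ := isEmptyElim f
  RelMap
    | .edge => fun x => Sum.isLeft (x 0) ≠ Sum.isLeft (x 1)
    | .part => fun x => Sum.isLeft (x 0) = Sum.isLeft (x 1)

/-! ### Endomorphisms and their images -/

/-- The set of endomorphisms (relation-preserving self-maps) of `M`. -/
def Endo (M : Type u) [lang.Structure M] : Type u := M →[lang] M

variable {M : Type u} [lang.Structure M]

/-- The endomorphism monoid, with maps written on the right: `f * g` is `f` followed by `g`. -/
instance : Monoid (Endo M) where
  mul f g := Hom.comp g f
  one := Hom.id lang M
  mul_assoc _ _ _ := rfl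
  one_mul _ := rfl
  mul_one _ := rfl

/-- The underlying map of an endomorphism. -/
def Endo.toFun (f : Endo M) : M → M := fun x => Hom.toFun f x

/-- The vertex set of the image of an endomorphism. -/
def Im (f : Endo M) : Type u := Set.range f.toFun

/-- The image `im f = (V f, E f, P f)`: its relations are the images under `f` of the relations
of `M`. -/
instance (f : Endo M) : lang.Structure (Im f) where
  funMap g _ := isEmptyElim g
  RelMap {n} r x := ∃ y : Fin n → M, RelMap r y ∧ ∀ i, f.toFun (y i) = (x i).1

end

end Bipartite

/-! Among regular elements, the `L`-class is determined by the vertex set of the image and the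
`R`-class by the kernel, so the task is to count the images and kernels occurring in one `D`-class.

Composing `f` with one-sided invertible endomorphisms stays inside the `D`-class. Sections that
choose freely among infinitely many copies of each vertex (`exists_sections`) move the image:
countably many ways always, one for each subset of the image when it is infinite. A finite image
leaves only countably many possibilities. If `f` separates two vertices of one part, retractions
sending extra vertices freely to either of them (`exists_retractions`) give continuum many kernels.
Otherwise the image is `K_{1,1}` and the kernel is forced to be the partition.

Both constructions rest on `exists_embedding` and `exists_extension`, which use only the extension
property `IsGeneric`. -/

theorem exists_of_wellFounded_step {A : Type*} {r : A → A → Prop} (wf : WellFounded r)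
    {C : A → Type*} (P : ∀ a, (∀ a', r a' a → C a') → C a → Prop)
    (h : ∀ a prev, ∃ x, P a prev x) : ∃ F : ∀ a, C a, ∀ a, P a (fun a' _ => F a') (F a) := by
  choose s hs using h
  refine ⟨wf.fix s, fun a => ?_⟩
  conv => arg 3; rw [wf.fix_eq]
  exact hs _ _

theorem finite_encode_lt {A : Type*} [Encodable A] (n : ℕ) :
    {a : A | Encodable.encode a < n}.Finite :=
  (Set.finite_Iio n).preimage Encodable.encode_injective.injOn

/-! ### Green's relations in an arbitrary monoid. -/

namespace Green

variable {S : Type u} [Monoid S]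

theorem lRel_iff {f g : S} : LRel f g ↔ (∃ m, m * f = g) ∧ ∃ m, m * g = f := by
  constructor
  · intro h
    have h1 : g ∈ Set.range (fun m : S => m * f) := by rw [h]; exact ⟨1, one_mul g⟩
    have h2 : f ∈ Set.range (fun m : S => m * g) := by rw [← h]; exact ⟨1, one_mul f⟩
    exact ⟨h1, h2⟩
  · rintro ⟨⟨m, rfl⟩, n, hn⟩
    refine Set.Subset.antisymm ?_ ?_
    · rintro _ ⟨k, rfl⟩
      exact ⟨k * n, by simp only [mul_assoc, hn]⟩
    · rintro _ ⟨k, rfl⟩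
      exact ⟨k * m, by simp only [mul_assoc]⟩

theorem rRel_iff {f g : S} : RRel f g ↔ (∃ m, f * m = g) ∧ ∃ m, g * m = f := by
  constructor
  · intro h
    have h1 : g ∈ Set.range (fun m : S => f * m) := by rw [h]; exact ⟨1, mul_one g⟩
    have h2 : f ∈ Set.range (fun m : S => g * m) := by rw [← h]; exact ⟨1, mul_one f⟩
    exact ⟨h1, h2⟩
  · rintro ⟨⟨m, rfl⟩, n, hn⟩
    refine Set.Subset.antisymm ?_ ?_
    · rintro _ ⟨k, rfl⟩
      exact ⟨n * k, by simp only [← mul_assoc, hn]⟩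
    · rintro _ ⟨k, rfl⟩
      exact ⟨m * k, by simp only [mul_assoc]⟩

theorem IsRegularElement.of_lRel {f g : S} (hf : IsRegularElement f) (h : LRel f g) :
    IsRegularElement g := by
  obtain ⟨x, hx⟩ := hf
  obtain ⟨⟨m, hm⟩, n, hn⟩ := lRel_iff.1 h
  refine ⟨x * n, ?_⟩
  calc g * (x * n) * g = m * (f * x * (n * g)) := by rw [← hm]; simp only [mul_assoc]
    _ = g := by rw [hn, hx, hm]

theorem IsRegularElement.of_rRel {f g : S} (hf : IsRegularElement f) (h : RRel f g) :
    IsRegularElement g := by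
  obtain ⟨x, hx⟩ := hf
  obtain ⟨⟨m, hm⟩, n, hn⟩ := rRel_iff.1 h
  refine ⟨n * x, ?_⟩
  calc g * (n * x) * g = g * n * x * f * m := by rw [← hm]; simp only [mul_assoc]
    _ = g := by rw [hn, hx, hm]

theorem IsRegularElement.of_dRel {f g : S} (hf : IsRegularElement f) (h : DRel f g) :
    IsRegularElement g := by
  obtain ⟨k, hk, hk'⟩ := h
  exact (hf.of_lRel hk).of_rRel hk'

/-- Since `p` undoes `k`, the product even stays in the `R`-class of `f`. -/
theorem dRel_mul_right {f k p : S} (h : k * p = 1) : DRel f (f * k) :=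
  ⟨f, rfl, rRel_iff.2 ⟨⟨k, rfl⟩, p, by rw [mul_assoc, h, mul_one]⟩⟩

theorem dRel_mul_left {f k p : S} (h : p * k = 1) : DRel f (k * f) :=
  ⟨k * f, lRel_iff.2 ⟨⟨k, rfl⟩, p, by rw [← mul_assoc, h, one_mul]⟩, rfl⟩

theorem lRel_of_class_eq {g h : S} (H : {k | LRel g k} = {k | LRel h k}) : LRel g h := by
  have : h ∈ {k | LRel g k} := by rw [H]; exact rfl
  exact this

theorem rRel_of_class_eq {g h : S} (H : {k | RRel g k} = {k | RRel h k}) : RRel g h := by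
  have : h ∈ {k | RRel g k} := by rw [H]; exact rfl
  exact this

theorem mk_lClassesInDClass_le (f : S) : #(lClassesInDClass f) ≤ #S :=
  (Cardinal.mk_le_mk_of_subset (t := Set.range fun g : S => {h | LRel g h})
    (by rintro _ ⟨g, -, rfl⟩; exact ⟨g, rfl⟩)).trans Cardinal.mk_range_le

theorem mk_rClassesInDClass_le (f : S) : #(rClassesInDClass f) ≤ #S :=
  (Cardinal.mk_le_mk_of_subset (t := Set.range fun g : S => {h | RRel g h})
    (by rintro _ ⟨g, -, rfl⟩; exact ⟨g, rfl⟩)).trans Cardinal.mk_range_le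

theorem lift_mk_le_lClassesInDClass {f : S} {X : Type*} (F : X → S) (hF : ∀ x, DRel f (F x))
    (inj : ∀ x y, LRel (F x) (F y) → x = y) :
    Cardinal.lift.{u} #X ≤ Cardinal.lift #(lClassesInDClass f) :=
  Cardinal.lift_mk_le_lift_mk_of_injective
    (f := fun x => (⟨{h | LRel (F x) h}, F x, hF x, rfl⟩ : lClassesInDClass f))
    fun x y hxy => inj x y (lRel_of_class_eq (Subtype.ext_iff.1 hxy))

theorem lift_mk_le_rClassesInDClass {f : S} {X : Type*} (F : X → S) (hF : ∀ x, DRel f (F x))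
    (inj : ∀ x y, RRel (F x) (F y) → x = y) :
    Cardinal.lift.{u} #X ≤ Cardinal.lift #(rClassesInDClass f) :=
  Cardinal.lift_mk_le_lift_mk_of_injective
    (f := fun x => (⟨{h | RRel (F x) h}, F x, hF x, rfl⟩ : rClassesInDClass f))
    fun x y hxy => inj x y (rRel_of_class_eq (Subtype.ext_iff.1 hxy))

end Green

namespace Bipartite

open FirstOrder FirstOrder.Language FirstOrder.Language.Structure

/-- The structure with given edge and partition relations. -/
abbrev structureOf {α : Type*} (E P : α → α → Prop) : lang.Structure α where
  funMap f _ := isEmptyElim f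
  RelMap
    | .edge => fun x => E (x 0) (x 1)
    | .part => fun x => P (x 0) (x 1)

theorem eq_vecCons {α : Type*} (x : Fin 2 → α) : x = ![x 0, x 1] := by
  funext i; fin_cases i <;> rfl

theorem comp_vecCons {α β : Type*} (g : α → β) (x : Fin 2 → α) : g ∘ x = ![g (x 0), g (x 1)] :=
  eq_vecCons _

theorem edge_substructure {M : Type*} [lang.Structure M] {S : lang.Substructure M} (x y : S) :
    Edge x y ↔ Edge (x : M) (y : M) :=
  iff_of_eq (congrArg (RelMap edgeSymb) (eq_vecCons fun i => ((![x, y] i : S) : M)))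

theorem part_substructure {M : Type*} [lang.Structure M] {S : lang.Substructure M} (x y : S) :
    Part x y ↔ Part (x : M) (y : M) :=
  iff_of_eq (congrArg (RelMap partSymb) (eq_vecCons fun i => ((![x, y] i : S) : M)))

theorem edge_embedding {M N : Type*} [lang.Structure M] [lang.Structure N] (g : M ↪[lang] N)
    (x y : M) : Edge (g x) (g y) ↔ Edge x y := by
  have := g.map_rel edgeSymb ![x, y]
  rwa [comp_vecCons] at this

theorem part_embedding {M N : Type*} [lang.Structure M] [lang.Structure N] (g : M ↪[lang] N)
    (x y : M) : Part (g x) (g y) ↔ Part x y := by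
  have := g.map_rel partSymb ![x, y]
  rwa [comp_vecCons] at this

section

variable {B : Type u} [lang.Structure B]

theorem Endo.ext {f g : Endo B} (h : ∀ x, f.toFun x = g.toFun x) : f = g :=
  FirstOrder.Language.Hom.ext h

theorem Endo.edge (f : Endo B) {x y : B} (h : Edge x y) : Edge (f.toFun x) (f.toFun y) := by
  have := Hom.map_rel' f edgeSymb ![x, y] h
  rwa [comp_vecCons] at this

theorem Endo.part (f : Endo B) {x y : B} (h : Part x y) : Part (f.toFun x) (f.toFun y) := by
  have := Hom.map_rel' f partSymb ![x, y] h
  rwa [comp_vecCons] at this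

theorem Endo.exists_toFun_eq (g : B → B) (he : ∀ x y, Edge x y → Edge (g x) (g y))
    (hp : ∀ x y, Part x y → Part (g x) (g y)) : ∃ f : Endo B, f.toFun = g := by
  refine ⟨({ toFun := g, map_fun' := fun f => isEmptyElim f, map_rel' := ?_ } :
    B →[lang] B), rfl⟩
  intro n r x h
  cases r with
  | edge =>
    rw [comp_vecCons]
    rw [eq_vecCons x] at h
    exact he _ _ h
  | part =>
    rw [comp_vecCons]
    rw [eq_vecCons x] at h
    exact hp _ _ h

/-- The characteristic properties of the countable universal bipartite graph, with respect to a
colouring `col` of its vertices by their parts. -/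
structure IsGeneric (col : B → Bool) : Prop where
  part : ∀ u v : B, Part u v ↔ col u = col v
  symm : ∀ u v : B, Edge u v → Edge v u
  cross : ∀ u v : B, Edge u v → col u ≠ col v
  extend : ∀ (c : Bool) (U W : Set B), U.Finite → W.Finite → (∀ u ∈ U, col u ≠ c) →
    ∃ v, col v = c ∧ v ∉ W ∧ (∀ u ∈ U, Edge u v) ∧ ∀ w ∈ W, w ∉ U → ¬ Edge w v

/-! ### The extension property of the Fraïssé limit. -/

/-- With the partition encoded by comparison with a base vertex `r`, each condition involves at most
three vertices and can be checked inside a finite substructure. -/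
theorem IsBipartiteGraph.of_finite_substructures
    (h : ∀ s : Set B, s.Finite → IsBipartiteGraph (Substructure.closure lang s)) (r : B) :
    (∀ u v : B, Edge u v → Edge v u) ∧ (∀ u v : B, Edge u v → ¬ Part u v) ∧
    (Part r r) ∧ ∀ u v : B, Part u v ↔ (Part u r ↔ Part v r) := by
  have key (u v : B) : (Edge u v → Edge v u) ∧ (Edge u v → ¬ Part u v) ∧
      (Part r r) ∧ (Part u v ↔ (Part u r ↔ Part v r)) := by
    have hS := h {u, v, r} (Set.toFinite _)
    set S := Substructure.closure lang ({u, v, r} : Set B)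
    have sub : ({u, v, r} : Set B) ⊆ S := Substructure.subset_closure
    let u' : S := ⟨u, sub (by simp)⟩
    let v' : S := ⟨v, sub (by simp)⟩
    let r' : S := ⟨r, sub (by simp)⟩
    obtain ⟨V, hV⟩ := hS.part
    have e1 := hS.symm u' v'
    have e2 := hS.disjoint u' v'
    have p1 := hV r' r'
    have p2 := hV u' v'
    have p3 := hV u' r'
    have p4 := hV v' r'
    simp only [edge_substructure, part_substructure, Set.mem_compl_iff, and_self]
      at e1 e2 p1 p2 p3 p4
    refine ⟨e1, e2, p1.2 (em _), p2.trans ?_⟩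
    rw [show Part u r ↔ _ from p3, show Part v r ↔ _ from p4]
    by_cases hu : u' ∈ V <;> by_cases hv : v' ∈ V <;> by_cases hr : r' ∈ V <;> simp [hu, hv, hr]
  exact ⟨fun u v => (key u v).1, fun u v => (key u v).2.1, (key r r).2.2.1,
    fun u v => (key u v).2.2.2⟩

open Classical in
theorem IsCountableUniversal.exists_isGeneric [Countable B] (hB : IsCountableUniversal B) :
    ∃ col : B → Bool, IsGeneric col := by
  have emb (N : Type u) [lang.Structure N] [Finite N] (hN : IsBipartiteGraph N) :
      Nonempty (N ↪[lang] B) := by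
    have : (⟨N, inferInstance⟩ : CategoryTheory.Bundled lang.Structure) ∈ lang.age B := by
      rw [hB.age]; exact ⟨‹_›, hN⟩
    exact this.2
  obtain ⟨r⟩ : Nonempty B := by
    let : lang.Structure PUnit.{u + 1} := structureOf (fun _ _ => False) (fun _ _ => True)
    obtain ⟨g⟩ := emb PUnit ⟨fun _ h => h, fun _ _ h => h,
      ⟨Set.univ, fun _ _ => iff_of_true trivial (by simp)⟩, fun _ _ h => h.elim⟩
    exact ⟨g PUnit.unit⟩
  obtain ⟨hsymm, hdisj, hr, hpart⟩ := IsBipartiteGraph.of_finite_substructures (fun s hs => by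
    have := age.fg_substructure (Substructure.fg_closure (L := lang) hs)
    rw [hB.age] at this
    exact this.2) r
  have hpart' (u v : B) : Part u v ↔ decide (Part u r) = decide (Part v r) := by
    rw [hpart, decide_eq_decide]
  refine ⟨fun v => decide (Part v r), hpart', hsymm, fun u v h => ?_, ?_⟩
  · exact fun h' => hdisj u v h ((hpart' u v).2 h')
  intro c U W hU hW hc
  let s : Set B := insert r (U ∪ W)
  have hs : s.Finite := (hU.union hW).insert r
  set S := Substructure.closure lang s
  have sub : s ⊆ S := Substructure.subset_closure
  have hSfg : S.FG := Substructure.fg_closure hs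
  have : Finite S := by
    have : (S : Set B) = s := Substructure.closure_eq_of_isRelational lang s
    have h2 : (S : Set B).Finite := this ▸ hs
    exact h2.to_subtype
  -- Adjoin to the finite substructure `S` a vertex `none` of colour `c` whose neighbours are
  -- exactly `U`. The age supplies a copy in `B`, and ultrahomogeneity makes it fix `S` pointwise.
  -- Having `r` in `S` lets the colour of the new vertex be read off.
  let E : Option S → Option S → Prop
    | none, none => False
    | none, some y => (y : B) ∈ U
    | some x, none => (x : B) ∈ U
    | some x, some y => Edge (x : B) y
  let k : Option S → Bool
    | none => c
    | some x => decide (Part (x : B) r)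
  let : lang.Structure (Option S) := structureOf E (fun x y => k x = k y)
  have hT : IsBipartiteGraph (Option S) := by
    refine ⟨?_, ?_, ⟨{x | k x = true}, ?_⟩, ?_⟩
    · rintro (_ | x) h
      · exact h
      · exact hdisj _ _ (show Edge (x : B) x from h) ((hpart' _ _).2 rfl)
    · rintro (_ | x) (_ | y) h
      · exact h
      · exact h
      · exact h
      · exact hsymm _ _ h
    · intro x y
      change k x = k y ↔ _
      simp only [Set.mem_compl_iff, Set.mem_ofPred_eq]
      cases k x <;> cases k y <;> simp
    · rintro (_ | x) (_ | y) h
      · exact fun _ => h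
      · exact fun h' => hc _ h (Eq.symm h')
      · exact fun h' => hc _ h h'
      · exact fun h' => hdisj _ _ h ((hpart' _ _).2 h')
  let g : S ↪[lang] Option S :=
    { toFun := some
      inj' := Option.some_injective _
      map_fun' := fun f => isEmptyElim f
      map_rel' := by
        intro n R x
        cases R with
        | edge =>
          rw [eq_vecCons x]
          exact (edge_substructure (x 0) (x 1)).symm
        | part =>
          rw [eq_vecCons x]
          exact ((part_substructure (x 0) (x 1)).trans (hpart' _ _)).symm }
  have := emb (Option S) hT
  obtain ⟨f', hf'⟩ := hB.ultrahomogeneous.extend_embedding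
    ((Substructure.fg_iff_structure_fg S).1 hSfg) S.subtype g
  have hf (x : B) (hx : x ∈ S) : f' (some ⟨x, hx⟩) = x := by
    have := DFunLike.congr_fun hf' ⟨x, hx⟩
    exact this.symm
  have hE (x : B) (hx : x ∈ S) : Edge x (f' none) ↔ x ∈ U := by
    have := edge_embedding f' (some ⟨x, hx⟩) none
    rw [hf] at this
    exact this
  have hUS (x : B) (hx : x ∈ U) : x ∈ S := sub (Or.inr (Or.inl hx))
  have hWS (x : B) (hx : x ∈ W) : x ∈ S := sub (Or.inr (Or.inr hx))
  refine ⟨f' none, ?_, ?_, ?_, ?_⟩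
  · have := part_embedding f' none (some ⟨r, sub (Or.inl rfl)⟩)
    rw [hf] at this
    have h2 : Part (f' none) r ↔ c = decide (Part r r) := this
    simp only [hr, decide_true] at h2
    simp only [h2]
    cases c <;> simp
  · intro hw
    have h1 := hf _ (hWS _ hw)
    have := f'.injective h1
    exact Option.some_ne_none _ this
  · exact fun u hu => (hE u (hUS u hu)).2 hu
  · exact fun w hw hn h => hn ((hE w (hWS w hw)).1 h)

/-! ### Building endomorphisms of a generic bipartite graph. -/

namespace IsGeneric

variable {col : B → Bool}

/-- Parts cannot merge: if `x` and `y` lie in different parts, some neighbour of `x` lies in the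
part of `y`, and its image is adjacent to that of `x`. -/
theorem col_endo (hB : IsGeneric col) (f : Endo B) {x y : B} :
    col (f.toFun x) = col (f.toFun y) ↔ col x = col y := by
  constructor
  · intro h
    by_contra hne
    obtain ⟨v, hv, -, he, -⟩ := hB.extend (col y) {x} ∅ (Set.finite_singleton x) Set.finite_empty
      (by rintro u rfl; exact hne)
    have h1 := hB.cross _ _ (f.edge (he x rfl))
    have h2 := (hB.part _ _).1 (f.part ((hB.part v y).2 hv))
    exact h1 (h.trans h2.symm)
  · exact fun h => (hB.part _ _).1 (f.part ((hB.part x y).2 h))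

open Classical in
-- The final finiteness clause is what makes `exists_extension` possible: the extension property
-- only handles finitely many prescribed neighbours.
theorem exists_embedding [Countable B] (hB : IsGeneric col) {A : Type*} [Countable A]
    (c : A → Bool) (adj : A → A → Prop) (hsymm : ∀ a b, adj a b → adj b a)
    (hadj : ∀ a b, adj a b → c a ≠ c b) :
    ∃ ι : A → B, Function.Injective ι ∧ (∀ a, col (ι a) = c a) ∧
      (∀ a b, Edge (ι a) (ι b) ↔ adj a b) ∧
      ∀ b, b ∉ Set.range ι → {a | Edge b (ι a)}.Finite := by
  let _ := Encodable.ofCountable A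
  let _ := Encodable.ofCountable B
  let enc : A → ℕ := Encodable.encode
  let encB : B → ℕ := Encodable.encode
  obtain ⟨F, hF⟩ := exists_of_wellFounded_step (r := fun a b : A => enc a < enc b)
    (InvImage.wf enc Nat.lt_wfRel.wf) (C := fun a => {b : B // col b = c a})
    (fun a prev x =>
      let U : Set B := {b | ∃ a' h, adj a' a ∧ (prev a' h).1 = b}
      -- Avoiding also an initial segment of `B` ensures that a vertex outside the range is adjacent
      -- only to images of the finitely many `a` with `enc a < encB b`.
      let W : Set B := {b | (∃ a' h, (prev a' h).1 = b) ∨ encB b < enc a + 1}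
      x.1 ∉ W ∧ (∀ b ∈ U, Edge b x.1) ∧ ∀ b ∈ W, b ∉ U → ¬ Edge b x.1) (by
    intro a prev
    have hfin : {b : B | ∃ a' h, (prev a' h).1 = b}.Finite := by
      have := (finite_encode_lt (A := A) (enc a)).to_subtype
      refine (Set.finite_range
        fun a' : {a' : A | Encodable.encode a' < enc a} => (prev a'.1 a'.2).1).subset ?_
      rintro b ⟨a', h, rfl⟩
      exact ⟨⟨a', h⟩, rfl⟩
    obtain ⟨v, hv, h⟩ := hB.extend (c a) {b | ∃ a' h, adj a' a ∧ (prev a' h).1 = b}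
      {b | (∃ a' h, (prev a' h).1 = b) ∨ encB b < enc a + 1}
      (hfin.subset (by rintro b ⟨a', h, -, rfl⟩; exact ⟨a', h, rfl⟩))
      (hfin.union (finite_encode_lt _))
      (by rintro u ⟨a', h, h1, rfl⟩; rw [(prev a' h).2]; exact hadj _ _ h1)
    exact ⟨⟨v, hv⟩, h⟩)
  have hlt (a b : A) (h : enc a < enc b) :
      (F b).1 ≠ (F a).1 := by
    intro he
    exact (hF b).1 (Or.inl ⟨a, h, he.symm⟩)
  have hinj : Function.Injective fun a => (F a).1 := by
    intro a b hab
    by_contra hne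
    rcases lt_or_gt_of_ne (fun h => hne (Encodable.encode_injective h) : enc a ≠ enc b) with h | h
    · exact hlt a b h hab.symm
    · exact hlt b a h hab
  have hedge (a b : A) (h : enc a < enc b) : Edge (F a).1 (F b).1 ↔ adj a b := by
    constructor
    · intro he
      by_contra hn
      refine (hF b).2.2 _ (Or.inl ⟨a, h, rfl⟩) ?_ he
      rintro ⟨a', h', h1, h2⟩
      exact hn (hinj h2 ▸ h1)
    · exact fun h1 => (hF b).2.1 _ ⟨a, h, h1, rfl⟩
  refine ⟨fun a => (F a).1, hinj, fun a => (F a).2, ?_, ?_⟩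
  · intro a b
    rcases lt_trichotomy (enc a) (enc b) with h | h | h
    · exact hedge a b h
    · obtain rfl : a = b := Encodable.encode_injective h
      exact iff_of_false (fun h => hB.cross _ _ h rfl) fun h => hadj _ _ h rfl
    · exact ⟨fun he => hsymm _ _ ((hedge b a h).1 (hB.symm _ _ he)),
        fun he => hB.symm _ _ ((hedge b a h).2 (hsymm _ _ he))⟩
  · intro b hb
    refine (finite_encode_lt (encB b)).subset fun a ha => ?_
    by_contra hle
    refine (hF a).2.2 b (Or.inr (Nat.lt_succ_of_le (not_lt.1 hle))) ?_ ha
    rintro ⟨a', _, _, h⟩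
    exact hb ⟨a', h⟩

open Classical in
-- Non-edges need not be preserved, so each vertex off the range only needs a common neighbour, in
-- the right part, of a finite set: the images of its neighbours in the range and of its earlier
-- neighbours.
theorem exists_extension [Countable B] (hB : IsGeneric col) {A : Type*} {ι : A → B}
    (hι : Function.Injective ι) (hfin : ∀ b, b ∉ Set.range ι → {a | Edge b (ι a)}.Finite)
    (φ : A → B) (hcol : ∀ a, col (φ a) = col (ι a))
    (hφ : ∀ a b, Edge (ι a) (ι b) → Edge (φ a) (φ b)) :
    ∃ h : Endo B, ∀ a, h.toFun (ι a) = φ a := by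
  let _ := Encodable.ofCountable B
  let enc : B → ℕ := Encodable.encode
  obtain ⟨F, hF⟩ := exists_of_wellFounded_step (r := fun a b : B => enc a < enc b)
    (InvImage.wf enc Nat.lt_wfRel.wf) (C := fun b => {v : B // col v = col b})
    (fun b prev x => (∀ a, ι a = b → x.1 = φ a) ∧ (b ∉ Set.range ι →
      (∀ a, Edge b (ι a) → Edge (φ a) x.1) ∧
      ∀ b' h, Edge b b' → Edge (prev b' h).1 x.1)) (by
    intro b prev
    by_cases hb : b ∈ Set.range ι
    · obtain ⟨a, rfl⟩ := hb
      exact ⟨⟨φ a, hcol a⟩, fun a' h => by rw [hι h], fun h => (h ⟨a, rfl⟩).elim⟩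
    have hfin' : {v : B | ∃ b' h, Edge b b' ∧ (prev b' h).1 = v}.Finite := by
      have := (finite_encode_lt (A := B) (enc b)).to_subtype
      refine (Set.finite_range
        fun a' : {a' : B | Encodable.encode a' < enc b} => (prev a'.1 a'.2).1).subset ?_
      rintro b ⟨a', h, -, rfl⟩
      exact ⟨⟨a', h⟩, rfl⟩
    obtain ⟨v, hv, -, hU, -⟩ := hB.extend (col b)
      (φ '' {a | Edge b (ι a)} ∪ {v : B | ∃ b' h, Edge b b' ∧ (prev b' h).1 = v}) ∅
      (((hfin b hb).image φ).union hfin') Set.finite_empty (by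
        rintro u (⟨a, ha, rfl⟩ | ⟨b', h, h1, rfl⟩)
        · rw [hcol]; exact (hB.cross _ _ ha).symm
        · rw [(prev b' h).2]; exact (hB.cross _ _ h1).symm)
    exact ⟨⟨v, hv⟩, fun a ha => (hb ⟨a, ha⟩).elim, fun _ =>
      ⟨fun a ha => hU _ (Or.inl ⟨a, ha, rfl⟩), fun b' h h1 => hU _ (Or.inr ⟨b', h, h1, rfl⟩)⟩⟩)
  have hFι (a : A) : (F (ι a)).1 = φ a := (hF (ι a)).1 a rfl
  obtain ⟨h, hh⟩ := Endo.exists_toFun_eq (fun b => (F b).1) (by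
      intro x y hxy
      by_cases hx : x ∈ Set.range ι <;> by_cases hy : y ∈ Set.range ι
      · obtain ⟨a, rfl⟩ := hx
        obtain ⟨b, rfl⟩ := hy
        simp only [hFι]
        exact hφ a b hxy
      · obtain ⟨a, rfl⟩ := hx
        simp only [hFι]
        exact ((hF y).2 hy).1 a (hB.symm _ _ hxy)
      · obtain ⟨b, rfl⟩ := hy
        simp only [hFι]
        exact hB.symm _ _ (((hF x).2 hx).1 b hxy)
      · rcases lt_trichotomy (enc x) (enc y) with h | h | h
        · exact ((hF y).2 hy).2 x h (hB.symm _ _ hxy)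
        · obtain rfl : x = y := Encodable.encode_injective h
          exact (hB.cross _ _ hxy rfl).elim
        · exact hB.symm _ _ (((hF x).2 hx).2 y h hxy)) (by
      intro x y hxy
      rw [hB.part] at hxy ⊢
      rw [(F x).2, (F y).2, hxy])
  exact ⟨h, fun a => by rw [hh]; exact hFι a⟩

/-- Infinitely many copies of every vertex: sections of a single endomorphism. -/
theorem exists_sections [Countable B] (hB : IsGeneric col) :
    ∃ (ι : B × ℕ → B) (p : Endo B), Function.Injective ι ∧
      ∀ q : B → ℕ, ∃ k : Endo B, k * p = 1 ∧ ∀ b, k.toFun b = ι (b, q b) := by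
  -- Adjacency ignores the index, so every choice of one copy per vertex is a homomorphism.
  obtain ⟨ι, hinj, hcol, hedge, hfin⟩ := hB.exists_embedding (A := B × ℕ) (fun a => col a.1)
    (fun a b => Edge a.1 b.1) (fun a b => hB.symm _ _) (fun a b => hB.cross _ _)
  obtain ⟨p, hp⟩ := hB.exists_extension hinj hfin Prod.fst (fun a => (hcol a).symm)
    (fun a b => (hedge a b).1)
  refine ⟨ι, p, hinj, fun q => ?_⟩
  obtain ⟨k, hk⟩ := Endo.exists_toFun_eq (fun b => ι (b, q b))
    (fun x y h => (hedge _ _).2 h)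
    (fun x y h => by rw [hB.part] at h ⊢; rw [hcol, hcol, h])
  refine ⟨k, Endo.ext fun x => ?_, fun b => by rw [hk]⟩
  change p.toFun (k.toFun x) = x
  rw [hk, hp]

open Classical in
/-- Retractions sending infinitely many extra vertices freely to two vertices of the same part. -/
theorem exists_retractions [Countable B] (hB : IsGeneric col) {u v : B} (huv : col u = col v) :
    ∃ (s : Endo B) (w : ℕ → B), ∀ X : Set ℕ, ∃ h : Endo B, s * h = 1 ∧
      ∀ n, h.toFun (w n) = if n ∈ X then u else v := by
  -- The extra vertices are isolated within this copy, so they may be sent anywhere in their part.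
  obtain ⟨ι, hinj, hcol, hedge, hfin⟩ := hB.exists_embedding (A := B ⊕ ℕ)
    (Sum.elim col fun _ => col u)
    (fun a b => ∃ x y, a = Sum.inl x ∧ b = Sum.inl y ∧ Edge x y)
    (by rintro _ _ ⟨x, y, rfl, rfl, h⟩; exact ⟨y, x, rfl, rfl, hB.symm _ _ h⟩)
    (by rintro _ _ ⟨x, y, rfl, rfl, h⟩; exact hB.cross _ _ h)
  obtain ⟨s, hs⟩ := Endo.exists_toFun_eq (fun b => ι (Sum.inl b))
    (fun x y h => (hedge _ _).2 ⟨x, y, rfl, rfl, h⟩)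
    (fun x y h => by rw [hB.part] at h ⊢; rw [hcol, hcol]; exact h)
  refine ⟨s, fun n => ι (Sum.inr n), fun X => ?_⟩
  obtain ⟨h, hh⟩ := hB.exists_extension hinj hfin (Sum.elim id fun n => if n ∈ X then u else v)
    (by
      rintro (b | n)
      · rw [hcol]; rfl
      · rw [hcol]
        simp only [Sum.elim_inr]
        split_ifs
        · rfl
        · exact huv.symm)
    (by
      intro a b hab
      obtain ⟨x, y, rfl, rfl, h⟩ := (hedge a b).1 hab
      exact h)
  refine ⟨h, Endo.ext fun x => ?_, fun n => hh _⟩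
  change h.toFun (s.toFun x) = x
  rw [hs, hh]
  rfl

end IsGeneric

/-! ### Counting classes -/

theorem mk_endo_le [Countable B] : #(Endo B) ≤ 𝔠 := by
  have h1 : #(Endo B) ≤ #(B → B) :=
    Cardinal.mk_le_of_injective (f := Endo.toFun) fun f g h => Endo.ext fun x => congrFun h x
  refine h1.trans ?_
  rw [← Cardinal.power_def, ← Cardinal.aleph0_power_aleph0]
  have hc : #B ≤ ℵ₀ := Cardinal.mk_le_aleph0
  exact (Cardinal.power_le_power_right hc).trans
    (Cardinal.power_le_power_left Cardinal.aleph0_ne_zero hc)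

theorem range_subset_of_mul_eq {f g m : Endo B} (h : m * f = g) :
    Set.range g.toFun ⊆ Set.range f.toFun := by
  rintro _ ⟨x, rfl⟩
  exact ⟨m.toFun x, by rw [← h]; rfl⟩

theorem range_eq_of_lRel {f g : Endo B} (h : Green.LRel f g) :
    Set.range f.toFun = Set.range g.toFun := by
  obtain ⟨⟨m, hm⟩, n, hn⟩ := Green.lRel_iff.1 h
  exact (range_subset_of_mul_eq hn).antisymm (range_subset_of_mul_eq hm)

/-- If `f * x * f = f`, then `x * f` fixes the range of `f` pointwise, so `g * x` is the required
factor. -/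
theorem exists_mul_eq_of_range_subset {f g : Endo B} (hf : Green.IsRegularElement f)
    (h : Set.range g.toFun ⊆ Set.range f.toFun) : ∃ m, m * f = g := by
  obtain ⟨x, hx⟩ := hf
  refine ⟨g * x, Endo.ext fun y => ?_⟩
  obtain ⟨z, hz⟩ := h ⟨y, rfl⟩
  change f.toFun (x.toFun (g.toFun y)) = g.toFun y
  rw [← hz]
  exact congrFun (congrArg Endo.toFun hx) z

theorem lRel_of_range_eq {f g : Endo B} (hf : Green.IsRegularElement f)
    (hg : Green.IsRegularElement g) (h : Set.range f.toFun = Set.range g.toFun) :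
    Green.LRel f g :=
  Green.lRel_iff.2 ⟨exists_mul_eq_of_range_subset hf h.ge, exists_mul_eq_of_range_subset hg h.le⟩

theorem exists_mul_eq_of_ker_le {f g : Endo B} (hf : Green.IsRegularElement f)
    (h : ∀ x y, f.toFun x = f.toFun y → g.toFun x = g.toFun y) : ∃ m, f * m = g := by
  obtain ⟨x, hx⟩ := hf
  exact ⟨x * g, Endo.ext fun y => h _ _ (congrFun (congrArg Endo.toFun hx) y)⟩

theorem rRel_of_ker_eq {f g : Endo B} (hf : Green.IsRegularElement f)
    (hg : Green.IsRegularElement g) (h : ∀ x y, f.toFun x = f.toFun y ↔ g.toFun x = g.toFun y) :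
    Green.RRel f g :=
  Green.rRel_iff.2 ⟨exists_mul_eq_of_ker_le hf fun x y => (h x y).1,
    exists_mul_eq_of_ker_le hg fun x y => (h x y).2⟩

theorem ker_eq_of_rRel {f g : Endo B} (h : Green.RRel f g) (x y : B) :
    f.toFun x = f.toFun y ↔ g.toFun x = g.toFun y := by
  obtain ⟨⟨m, hm⟩, n, hn⟩ := Green.rRel_iff.1 h
  constructor
  · intro h; rw [← hm]; exact congrArg m.toFun h
  · intro h; rw [← hn]; exact congrArg n.toFun h

theorem finite_range_of_dRel {f g : Endo B} (h : Green.DRel f g)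
    (hf : (Set.range f.toFun).Finite) : (Set.range g.toFun).Finite := by
  obtain ⟨k, hk, hk'⟩ := h
  rw [range_eq_of_lRel hk] at hf
  obtain ⟨⟨m, rfl⟩, -⟩ := Green.rRel_iff.1 hk'
  refine (hf.image m.toFun).subset ?_
  rintro _ ⟨x, rfl⟩
  exact ⟨_, ⟨x, rfl⟩, rfl⟩

variable {col : B → Bool}

theorem IsGeneric.nonempty (hB : IsGeneric col) (c : Bool) : ∃ b : B, col b = c := by
  obtain ⟨v, hv, -⟩ := hB.extend c ∅ ∅ Set.finite_empty Set.finite_empty (by simp)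
  exact ⟨v, hv⟩

theorem mk_lClasses_of_finite [Countable B] (hB : IsGeneric col) {f : Endo B}
    (hf : Green.IsRegularElement f)
    (hfin : (Set.range f.toFun).Finite) : #(Green.lClassesInDClass f) = ℵ₀ := by
  apply le_antisymm
  · choose g hg hC using fun C : Green.lClassesInDClass f => C.2
    -- The finite range determines the class, and a countable set has only countably many finite
    -- subsets.
    refine Cardinal.mk_le_aleph0_iff.2 (Function.Injective.countable
      (f := fun C => (finite_range_of_dRel (hg C) hfin).toFinset) fun C D h => ?_)
    have hr : Set.range (g C).toFun = Set.range (g D).toFun := by simpa using h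
    have hL := lRel_of_range_eq (hf.of_dRel (hg C)) (hf.of_dRel (hg D)) hr
    refine Subtype.ext ?_
    rw [hC C, hC D]
    ext k
    exact ⟨fun h => (Eq.symm hL).trans h, fun h => Eq.trans hL h⟩
  · obtain ⟨ι, p, hinj, hk⟩ := hB.exists_sections
    choose k hkp hkι using fun n : ℕ => hk fun _ => n
    obtain ⟨b, -⟩ := hB.nonempty true
    have := Green.lift_mk_le_lClassesInDClass (f := f) (fun n => f * k n)
      (fun n => Green.dRel_mul_right (hkp n)) (by
        intro m n h
        have hr := range_eq_of_lRel h
        have : (f * k m).toFun b ∈ Set.range (f * k n).toFun := hr ▸ ⟨b, rfl⟩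
        obtain ⟨x, hx⟩ := this
        change (k n).toFun (f.toFun x) = (k m).toFun (f.toFun b) at hx
        rw [hkι, hkι] at hx
        exact (congrArg Prod.snd (hinj hx)).symm)
    simpa using this

open Classical in
theorem mk_lClasses_of_infinite [Countable B] (hB : IsGeneric col) {f : Endo B}
    (hinf : (Set.range f.toFun).Infinite) : #(Green.lClassesInDClass f) = 𝔠 := by
  apply le_antisymm ((Green.mk_lClassesInDClass_le f).trans mk_endo_le)
  obtain ⟨ι, p, hinj, hk⟩ := hB.exists_sections
  -- Copy 1 is chosen exactly over `X`, so the new image reveals `X`.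
  choose k hkp hkι using fun X : Set (Set.range f.toFun) =>
    hk fun b => if ∃ h : b ∈ Set.range f.toFun, ⟨b, h⟩ ∈ X then 1 else 0
  have key (X Y : Set (Set.range f.toFun)) (h : Green.LRel (f * k X) (f * k Y)) : X ⊆ Y := by
    rintro ⟨_, x, rfl⟩ hb
    have hr := range_eq_of_lRel h
    have : (f * k X).toFun x ∈ Set.range (f * k Y).toFun := hr ▸ ⟨x, rfl⟩
    obtain ⟨y, hy⟩ := this
    change (k Y).toFun (f.toFun y) = (k X).toFun (f.toFun x) at hy
    have h1 := Prod.mk_inj.1 (hinj ((hkι Y _).symm.trans (hy.trans (hkι X _))))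
    rw [h1.1] at h1
    by_contra hn
    rw [if_neg (fun h => hn h.2), if_pos ⟨⟨x, rfl⟩, hb⟩] at h1
    exact zero_ne_one h1.2
  have hle := Green.lift_mk_le_lClassesInDClass (f := f) (fun X => f * k X)
    (fun X => Green.dRel_mul_right (hkp X)) fun X Y h =>
      (key X Y h).antisymm (key Y X h.symm)
  have := hinf.to_subtype
  have hT : #(Set.range f.toFun) = ℵ₀ := Cardinal.mk_eq_aleph0 _
  rw [Cardinal.mk_set, hT] at hle
  simpa using hle

open Classical in
theorem mk_rClasses_of_ne [Countable B] (hB : IsGeneric col) {f : Endo B} {u v : B}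
    (huv : col u = col v)
    (hne : f.toFun u ≠ f.toFun v) : #(Green.rClassesInDClass f) = 𝔠 := by
  apply le_antisymm ((Green.mk_rClassesInDClass_le f).trans mk_endo_le)
  obtain ⟨s, w, hh⟩ := hB.exists_retractions huv
  choose h hsh hw using hh
  -- The kernel recovers `X`: the test vertex `s.toFun u` does not depend on `X`, and `h X` sends it
  -- to `u`.
  have hmem (X : Set ℕ) (n : ℕ) :
      (h X * f).toFun (w n) = (h X * f).toFun (s.toFun u) ↔ n ∈ X := by
    have h1 : (h X).toFun (s.toFun u) = u := congrFun (congrArg Endo.toFun (hsh X)) u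
    change f.toFun ((h X).toFun (w n)) = f.toFun ((h X).toFun (s.toFun u)) ↔ _
    rw [h1, hw]
    by_cases hn : n ∈ X
    · simp [hn]
    · simp [hn, hne.symm]
  have := Green.lift_mk_le_rClassesInDClass (f := f) (fun X => h X * f)
    (fun X => Green.dRel_mul_left (hsh X)) (by
      intro X Y hXY
      ext n
      rw [← hmem X, ← hmem Y, ker_eq_of_rRel hXY])
  simpa using this

/-- The range of `f` has one vertex in each part. An `L`-related map has the same range, so its
kernel is again the partition; the whole `D`-class is therefore one `R`-class. -/
theorem mk_rClasses_of_forall_eq (hB : IsGeneric col) {f : Endo B} (hf : Green.IsRegularElement f)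
    (h : ∀ u v, col u = col v → f.toFun u = f.toFun v) : #(Green.rClassesInDClass f) = 1 := by
  rw [Cardinal.mk_set_eq_one_iff]
  refine ⟨{k | Green.RRel f k}, Set.Subset.antisymm ?_ ?_⟩
  · rintro _ ⟨g, ⟨k, hk, hkg⟩, rfl⟩
    have hker (g : Endo B) {x y : B} (h : g.toFun x = g.toFun y) : col x = col y :=
      (hB.col_endo g).1 (congrArg col h)
    have hfk : Green.RRel f k := by
      refine rRel_of_ker_eq hf (hf.of_lRel hk) fun x y =>
        ⟨fun hxy => ?_, fun hxy => h _ _ (hker k hxy)⟩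
      have hr := range_eq_of_lRel hk
      obtain ⟨x', hx'⟩ : k.toFun x ∈ Set.range f.toFun := hr ▸ ⟨x, rfl⟩
      obtain ⟨y', hy'⟩ : k.toFun y ∈ Set.range f.toFun := hr ▸ ⟨y, rfl⟩
      rw [← hx', ← hy']
      refine h _ _ ((hB.col_endo f).1 ?_)
      rw [hx', hy', hB.col_endo k]
      exact hker f hxy
    have hfg : Green.RRel f g := Eq.trans hfk hkg
    refine Set.mem_singleton_iff.2 (Set.ext fun m => ?_)
    exact ⟨fun h => Eq.trans hfg h, fun h => Eq.trans (Eq.symm hfg) h⟩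
  · rintro _ rfl
    exact ⟨f, ⟨f, rfl, rfl⟩, rfl⟩

/-! ### Recognising `K_{1,1}` as an image, and the final count. -/

theorem nonempty_equiv_completeGraph_iff (hB : IsGeneric col) (f : Endo B) :
    Nonempty (Im f ≃[lang] CompleteGraph 1 1) ↔
      ∀ u v, col u = col v → f.toFun u = f.toFun v := by
  constructor
  · rintro ⟨e⟩ u v huv
    let a : Im f := ⟨f.toFun u, u, rfl⟩
    let b : Im f := ⟨f.toFun v, v, rfl⟩
    have hab : RelMap partSymb ![a, b] := by
      refine ⟨![u, v], (hB.part u v).2 huv, fun i => ?_⟩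
      fin_cases i <;> rfl
    have h := (e.map_rel partSymb ![a, b]).2 hab
    have h' : Sum.isLeft (e a) = Sum.isLeft (e b) := h
    have hK : ∀ x y : Fin 1 ⊕ Fin 1, Sum.isLeft x = Sum.isLeft y → x = y := by decide
    exact congrArg Subtype.val (e.injective (hK _ _ h'))
  · intro h
    obtain ⟨r, hr⟩ := hB.nonempty true
    obtain ⟨s, hs, -, hrs, -⟩ := hB.extend false {r} ∅ (Set.finite_singleton r) Set.finite_empty
      (by rintro u rfl; simp [hr])
    replace hrs := hrs r rfl
    let c : Fin 1 ⊕ Fin 1 → B := Sum.elim (fun _ => r) (fun _ => s)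
    have hc (x : Fin 1 ⊕ Fin 1) : col (c x) = x.isLeft := by
      rcases x with x | x
      · exact hr
      · exact hs
    have hK : ∀ x y : Fin 1 ⊕ Fin 1, Sum.isLeft x = Sum.isLeft y → x = y := by decide
    have hcE (x y : Fin 1 ⊕ Fin 1) (hxy : x.isLeft ≠ y.isLeft) : Edge (c x) (c y) := by
      rcases x with x | x <;> rcases y with y | y
      · exact (hxy rfl).elim
      · exact hrs
      · exact hB.symm _ _ hrs
      · exact (hxy rfl).elim
    let g : CompleteGraph 1 1 → Im f := fun x => ⟨f.toFun (c x), c x, rfl⟩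
    have hg : Function.Bijective g := by
      constructor
      · intro x y hxy
        have h1 : f.toFun (c x) = f.toFun (c y) := congrArg Subtype.val hxy
        have h2 := (hB.col_endo f).1 (congrArg col h1)
        exact hK _ _ ((hc x).symm.trans (h2.trans (hc y)))
      · rintro ⟨_, u, rfl⟩
        have : ∃ x, col (c x) = col u := by
          cases hu : col u
          · exact ⟨Sum.inr 0, hs⟩
          · exact ⟨Sum.inl 0, hr⟩
        obtain ⟨x, hx⟩ := this
        exact ⟨x, Subtype.ext (h _ _ hx)⟩
    -- Relations of the image are witnessed by arbitrary preimages, whose colours are nevertheless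
    -- determined because `f` reflects colours.
    have hcol {x : CompleteGraph 1 1} {u : B} (hu : f.toFun u = (g x).1) :
        col u = Sum.isLeft x :=
      ((hB.col_endo f).1 (congrArg col hu)).trans (hc x)
    let e : CompleteGraph 1 1 ≃[lang] Im f :=
      { toEquiv := _root_.Equiv.ofBijective g hg
        map_fun' := fun f => isEmptyElim f
        map_rel' := by
          intro n R x
          cases R with
          | edge =>
            constructor
            · rintro ⟨y, hy, hyx⟩
              rw [eq_vecCons y] at hy
              have := hB.cross _ _ hy
              rw [hcol (hyx 0), hcol (hyx 1)] at this
              exact this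
            · intro hx
              exact ⟨![c (x 0), c (x 1)], hcE _ _ hx, fun i => by fin_cases i <;> rfl⟩
          | part =>
            constructor
            · rintro ⟨y, hy, hyx⟩
              rw [eq_vecCons y] at hy
              have := (hB.part _ _).1 hy
              rw [hcol (hyx 0), hcol (hyx 1)] at this
              exact this
            · intro hx
              exact ⟨![c (x 0), c (x 1)],
                (hB.part _ _).2 ((hc _).trans (Eq.trans hx (hc _).symm)),
                fun i => by fin_cases i <;> rfl⟩ }
    exact ⟨e.symm⟩

theorem exists_ne_of_not_equiv (hB : IsGeneric col) {f : Endo B}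
    (h : ¬ Nonempty (Im f ≃[lang] CompleteGraph 1 1)) :
    ∃ u v, col u = col v ∧ f.toFun u ≠ f.toFun v := by
  rw [nonempty_equiv_completeGraph_iff hB] at h
  push Not at h
  exact h

end

theorem finite_of_equiv_completeGraph {M : Type*} [lang.Structure M] {m n : ℕ}
    (h : Nonempty (M ≃[lang] CompleteGraph m n)) : Finite M := by
  obtain ⟨e⟩ := h
  exact Finite.of_injective (β := Fin m ⊕ Fin n) e e.injective

end Bipartite

theorem mainTheorem10 {B : Type u} [Bipartite.lang.Structure B] [Countable B]
    (hB : Bipartite.IsCountableUniversal B) (f : Bipartite.Endo B)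
    (hf : Green.IsRegularElement f) :
    (Infinite (Bipartite.Im f) →
      #(Green.lClassesInDClass f) = 𝔠 ∧ #(Green.rClassesInDClass f) = 𝔠) ∧
    (Finite (Bipartite.Im f) →
      ¬ Nonempty (Bipartite.Im f ≃[Bipartite.lang] Bipartite.CompleteGraph 1 1) →
      #(Green.lClassesInDClass f) = ℵ₀ ∧ #(Green.rClassesInDClass f) = 𝔠) ∧
    (Nonempty (Bipartite.Im f ≃[Bipartite.lang] Bipartite.CompleteGraph 1 1) →
      #(Green.lClassesInDClass f) = ℵ₀ ∧ #(Green.rClassesInDClass f) = 1) := by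
  obtain ⟨col, hcol⟩ := hB.exists_isGeneric
  have fin (h : Finite (Bipartite.Im f)) : (Set.range f.toFun).Finite := Set.finite_coe_iff.1 h
  refine ⟨fun h => ⟨?_, ?_⟩, fun h hK => ⟨?_, ?_⟩, fun hK => ⟨?_, ?_⟩⟩
  · exact Bipartite.mk_lClasses_of_infinite hcol (Set.infinite_coe_iff.1 h)
  · obtain ⟨u, v, huv, hne⟩ := Bipartite.exists_ne_of_not_equiv hcol
      fun hK => h.not_finite (Bipartite.finite_of_equiv_completeGraph hK)
    exact Bipartite.mk_rClasses_of_ne hcol huv hne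
  · exact Bipartite.mk_lClasses_of_finite hcol hf (fin h)
  · obtain ⟨u, v, huv, hne⟩ := Bipartite.exists_ne_of_not_equiv hcol hK
    exact Bipartite.mk_rClasses_of_ne hcol huv hne
  · exact Bipartite.mk_lClasses_of_finite hcol hf
      (fin (Bipartite.finite_of_equiv_completeGraph hK))
  · exact Bipartite.mk_rClasses_of_forall_eq hcol hf
      ((Bipartite.nonempty_equiv_completeGraph_iff hcol f).1 hK)
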